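/- Let $K$ be a field and let $A$ be a finite-dimensional $K$-algebra. Write $D=\operatorname{Hom}_K(-,K)$, let $\operatorname{mod-}A$ be the category of finite-dimensional right $A$-modules, and let $\nu=D\operatorname{Hom}_A(-,A)\colon \operatorname{mod-}A\to\operatorname{mod-}A$ be the Nakayama functor (which is naturally isomorphic to $-\otimes_A D(A)$). Call $A$ \emph{gendo-symmetric} if there are a finite-dimensional symmetric $K$-algebra $B$ (that is, $B\cong D(B)$ as $B$-bimodules) and a finite-dimensional right $B$-module $M$ that is a generator (that is, $B_B$ is a direct summand of $M^n$ for some $n$) such that $A\cong\operatorname{End}_B(M)$ as $K$-algebras. Then the following are equivalent: 1. $A$ is gendo-symmetric. 2. $\nu$ is a comonad, that is, there are natural transformations $\varepsilon\colon\nu\to\operatorname{id}$ and $\delta\colon\nu\to\nu\circ\nu$ which make $\nu$ a comonad on $\operatorname{mod-}A$ (coassociative and counital). -/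

import Mathlib

open CategoryTheory

universe u

/-!
Throughout, a right module over a ring `A` is a module over `Aᵐᵒᵖ`.  A finite-dimensional right
module over a finite-dimensional algebra is the same thing as a finitely generated one, so that
the category of finite-dimensional right `A`-modules is `FGModuleCat Aᵐᵒᵖ`.
-/

/-- A `K`-algebra `B` is symmetric if it is finite-dimensional and isomorphic to its dual
`D(B) = Hom_K(B, K)` as a `B`-bimodule, where `(b • f • c) x = f (c * x * b)`. -/
def IsSymmetricAlg (K : Type u) [Field K] (B : Type u) [Ring B] [Algebra K B] : Prop :=
  FiniteDimensional K B ∧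
    ∃ φ : B ≃ₗ[K] Module.Dual K B, ∀ b y c x : B, φ (b * y * c) x = φ y (c * x * b)

/-- A right `B`-module `M` is a generator if the regular right module `B` is a direct summand
of a finite direct sum of copies of `M`. -/
def IsRightGenerator (B : Type u) [Ring B] (M : Type u) [AddCommGroup M] [Module Bᵐᵒᵖ M] : Prop :=
  ∃ (n : ℕ) (i : B →ₗ[Bᵐᵒᵖ] (Fin n → M)) (p : (Fin n → M) →ₗ[Bᵐᵒᵖ] B), p ∘ₗ i = LinearMap.id

/-- A `K`-algebra `A` is gendo-symmetric if it is isomorphic, as a `K`-algebra, to the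
endomorphism algebra of a finite-dimensional generator `M` in the category of right modules over
a finite-dimensional symmetric `K`-algebra `B`. -/
def IsGendoSymmetric (K : Type u) [Field K] (A : Type u) [Ring A] [Algebra K A] : Prop :=
  ∃ (B : Type u) (_ : Ring B) (_ : Algebra K B)
    (M : Type u) (_ : AddCommGroup M) (_ : Module K M) (_ : Module Bᵐᵒᵖ M)
    (_ : IsScalarTower K Bᵐᵒᵖ M),
    IsSymmetricAlg K B ∧ FiniteDimensional K M ∧ IsRightGenerator B M ∧
      Nonempty (A ≃ₐ[K] Module.End Bᵐᵒᵖ M)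

section Nakayama

variable (K : Type u) [Field K] (A : Type u) [Ring A] [Algebra K A]

/-- The underlying vector space `D Hom_A(X, A) = Hom_K(Hom_A(X, A), K)` of the Nakayama functor,
for a right `A`-module `X`. -/
def NakayamaObj (X : Type u) [AddCommGroup X] [Module Aᵐᵒᵖ X] : Type u :=
  Module.Dual K (X →ₗ[Aᵐᵒᵖ] A)

namespace NakayamaObj

variable (X : Type u) [AddCommGroup X] [Module Aᵐᵒᵖ X]

instance : AddCommGroup (NakayamaObj K A X) :=
  inferInstanceAs (AddCommGroup (Module.Dual K (X →ₗ[Aᵐᵒᵖ] A)))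

instance : Module K (NakayamaObj K A X) :=
  inferInstanceAs (Module K (Module.Dual K (X →ₗ[Aᵐᵒᵖ] A)))

/-- An element of `D Hom_A(X, A)` as a functional on `Hom_A(X, A)`. -/
def toDual : NakayamaObj K A X ≃ₗ[K] Module.Dual K (X →ₗ[Aᵐᵒᵖ] A) :=
  LinearEquiv.refl K (Module.Dual K (X →ₗ[Aᵐᵒᵖ] A))

variable {K A X} in
theorem ext {f g : NakayamaObj K A X} (h : ∀ t, toDual K A X f t = toDual K A X g t) : f = g :=
  (toDual K A X).injective (LinearMap.ext h)

variable {A} in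
/-- Left multiplication by `a` on the left `A`-module `Hom_A(X, A)`: `(a • h) x = a * h x`. -/
def leftMul (a : A) : (X →ₗ[Aᵐᵒᵖ] A) →ₗ[K] (X →ₗ[Aᵐᵒᵖ] A) where
  toFun h := a • h
  map_add' h h' := smul_add a h h'
  map_smul' c h := by
    ext x
    simp

instance : SMul Aᵐᵒᵖ (NakayamaObj K A X) where
  smul a f := (toDual K A X).symm (toDual K A X f ∘ₗ leftMul K X a.unop)

theorem toDual_smul (a : Aᵐᵒᵖ) (f : NakayamaObj K A X) (h : X →ₗ[Aᵐᵒᵖ] A) :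
    toDual K A X (a • f) h = toDual K A X f (a.unop • h) := rfl

/-- The right `A`-module structure on `D Hom_A(X, A)`: `(f • a) h = f (a • h)`. -/
instance : Module Aᵐᵒᵖ (NakayamaObj K A X) where
  one_smul f := ext fun h => by simp [toDual_smul]
  mul_smul a b f := ext fun h => by simp [toDual_smul, mul_smul]
  smul_zero a := ext fun h => by simp [toDual_smul]
  smul_add a f g := ext fun h => by simp [toDual_smul]
  add_smul a b f := ext fun h => by simp [toDual_smul, add_smul]
  zero_smul f := ext fun h => by simp [toDual_smul]

instance : IsScalarTower K Aᵐᵒᵖ (NakayamaObj K A X) where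
  smul_assoc c a f := ext fun h => by simp [toDual_smul]

variable {X} in
theorem finite_hom [FiniteDimensional K A] [Module.Finite Aᵐᵒᵖ X] :
    FiniteDimensional K (X →ₗ[Aᵐᵒᵖ] A) := by
  obtain ⟨n, s, hs⟩ := Module.Finite.exists_fin (R := Aᵐᵒᵖ) (M := X)
  let ev : (X →ₗ[Aᵐᵒᵖ] A) →ₗ[K] (Fin n → A) :=
    { toFun := fun h j => h (s j)
      map_add' := fun _ _ => rfl
      map_smul' := fun _ _ => rfl }
  refine FiniteDimensional.of_injective ev fun h h' hh => ?_
  exact LinearMap.ext_on_range hs fun j => congrFun hh j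

instance [FiniteDimensional K A] [Module.Finite Aᵐᵒᵖ X] :
    Module.Finite Aᵐᵒᵖ (NakayamaObj K A X) := by
  have := finite_hom K A (X := X)
  have : Module.Finite K (NakayamaObj K A X) :=
    inferInstanceAs (Module.Finite K (Module.Dual K (X →ₗ[Aᵐᵒᵖ] A)))
  exact Module.Finite.of_restrictScalars_finite K Aᵐᵒᵖ _

variable {X} {Y : Type u} [AddCommGroup Y] [Module Aᵐᵒᵖ Y]

/-- The map `D Hom_A(g, A) : D Hom_A(X, A) → D Hom_A(Y, A)` induced by `g : X → Y`. It sends `f`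
to the functional `h ↦ f (h ∘ g)`. -/
def map (g : X →ₗ[Aᵐᵒᵖ] Y) : NakayamaObj K A X →ₗ[Aᵐᵒᵖ] NakayamaObj K A Y where
  toFun f := (toDual K A Y).symm (toDual K A X f ∘ₗ
    { toFun := fun h => h ∘ₗ g
      map_add' := fun _ _ => rfl
      map_smul' := fun _ _ => rfl })
  map_add' _ _ := rfl
  map_smul' _ _ := rfl

theorem toDual_map (g : X →ₗ[Aᵐᵒᵖ] Y) (f : NakayamaObj K A X) (h : Y →ₗ[Aᵐᵒᵖ] A) :
    toDual K A Y (map K A g f) h = toDual K A X f (h ∘ₗ g) := rfl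

end NakayamaObj

/-- The Nakayama functor `ν = D Hom_A(-, A)` on the category of finite-dimensional right
modules over a finite-dimensional `K`-algebra `A`. -/
def nakayamaFunctor [FiniteDimensional K A] : FGModuleCat.{u} Aᵐᵒᵖ ⥤ FGModuleCat.{u} Aᵐᵒᵖ where
  obj X := FGModuleCat.of Aᵐᵒᵖ (NakayamaObj K A X)
  map g := FGModuleCat.ofHom (NakayamaObj.map K A g.hom.hom)
  map_id _ := rfl
  map_comp _ _ := rfl

end Nakayama

/-!
Both conditions are equivalent to the existence of a linear map `ε : D(A) → A` with
`ε(c) c' = c ε(c')` for which `a ↦ a ε` is a bijection from `A` to `Hom_A(D(A), A)`.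

Such a map extends to a transformation `ν ⟶ 𝟭` given by `x ⊗ c ↦ x ε(c)`. The first property says
that `ν ε = ε ν`, and the second that `Hom_A(ε, A)` is bijective, so that `ν ε` is invertible: `ε`
is the counit of an idempotent comonad. Conversely, every homomorphism `D(A) → A` factors through
the counit of a comonad at `A`, since endomorphisms of `D(A)` are multiplications by elements of
`A`; together with the counit laws this gives both properties.

If `A = End_B(M)` for an algebra `B` with symmetrizing form `τ`, then `ε` sends the matrix
coefficient `a ↦ τ(s(a m))` to the rank one endomorphism `x ↦ m s(x)`, and the second property holds
because `M` is a generator. Conversely, the image of `ε` is an idempotent ideal, hence of the form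
`A e A` for an idempotent `e = ε(θ)`. Then `θ` induces a symmetrizing form on `End_A(A e) ≅ e A e`,
over which `A e` is a generator, and `A` is the endomorphism ring of `A e` because `a ↦ a ε` is
bijective.
-/

theorem eq_of_forall_dual_apply_eq {K V : Type*} [CommSemiring K] [AddCommMonoid V] [Module K V]
    [Module.Projective K V] {v w : V} (h : ∀ c : Module.Dual K V, c v = c w) : v = w :=
  Module.eval_apply_injective K (LinearMap.ext h)

section IdempotentComonad

variable {C : Type*} [Category* C]

/-- The comonad structure on an endofunctor `F` given by a transformation `ε : F ⟶ 𝟭 C` such that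
`F ε = ε F` is invertible. Comonads arising in this way are called idempotent. -/
noncomputable def idempotentComonad (F : C ⥤ C) (ε : F ⟶ 𝟭 C) [∀ X, IsIso (F.map (ε.app X))]
    (h : ∀ X, F.map (ε.app X) = ε.app (F.obj X)) : Comonad C where
  toFunctor := F
  ε := ε
  δ :=
    { app X := inv (F.map (ε.app X))
      naturality X Y f := by
        rw [IsIso.comp_inv_eq, Category.assoc, IsIso.eq_inv_comp]
        simp only [Functor.comp_map, ← F.map_comp]
        exact congrArg F.map (ε.naturality f).symm }
  coassoc X := by
    simp only [Functor.map_inv, h]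
  left_counit X := by simp [← h]
  right_counit X := by simp

end IdempotentComonad

section OrbitMap

variable {A X : Type*} [Ring A] [AddCommGroup X] [Module Aᵐᵒᵖ X]

/-- The homomorphism `a ↦ x a` of right modules determined by an element `x`. -/
def orbitMap (x : X) : A →ₗ[Aᵐᵒᵖ] X where
  toFun a := MulOpposite.op a • x
  map_add' a b := by simp [add_smul]
  map_smul' a b := by simp [mul_smul]

theorem orbitMap_apply (x : X) (a : A) : orbitMap x a = MulOpposite.op a • x := rfl

theorem orbitMap_apply_one (x : X) : orbitMap x (1 : A) = x := one_smul Aᵐᵒᵖ x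

theorem orbitMap_map_one (h : A →ₗ[Aᵐᵒᵖ] X) : orbitMap (h 1) = h :=
  LinearMap.ext fun a => by rw [orbitMap_apply, ← map_smul]; simp

end OrbitMap

/-- A linear map `ε : D(A) → A` with `ε(c) c' = c ε(c')` in `D(A)` for which `a ↦ a ε` is a
bijection from `A` to the right linear maps `D(A) → A`. Such a map is automatically a map of
bimodules. It is the component at `A` of the counit of a comonad structure on `ν`. -/
structure IsNakayamaCounit {K A : Type*} [CommRing K] [Ring A] [Algebra K A]
    (ε : Module.Dual K A →ₗ[K] A) : Prop where
  comm : ∀ (c c' : Module.Dual K A) (x : A), c' (x * ε c) = c (ε c' * x)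
  faithful : ∀ a, (∀ c, a * ε c = 0) → a = 0
  full : ∀ f : Module.Dual K A →ₗ[K] A, (∀ a c, f (c ∘ₗ LinearMap.mulLeft K a) = f c * a) →
    ∃ a, ∀ c, f c = a * ε c

namespace IsNakayamaCounit

variable {K A : Type*} [CommRing K] [Ring A] [Algebra K A] {ε : Module.Dual K A →ₗ[K] A}

theorem symm (hε : IsNakayamaCounit ε) (c c' : Module.Dual K A) : c' (ε c) = c (ε c') := by
  simpa using hε.comm c c' 1

theorem eq_of_forall_mul_eq (hε : IsNakayamaCounit ε) {a b : A} (h : ∀ c, a * ε c = b * ε c) :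
    a = b :=
  sub_eq_zero.1 (hε.faithful _ fun c => by rw [sub_mul, h, sub_self])

variable [Module.Projective K A]

theorem map_mulRight (hε : IsNakayamaCounit ε) (a : A) (c : Module.Dual K A) :
    ε (c ∘ₗ LinearMap.mulRight K a) = a * ε c :=
  eq_of_forall_dual_apply_eq fun c' => by
    rw [hε.symm, hε.comm]
    rfl

theorem map_mulLeft (hε : IsNakayamaCounit ε) (a : A) (c : Module.Dual K A) :
    ε (c ∘ₗ LinearMap.mulLeft K a) = ε c * a :=
  eq_of_forall_dual_apply_eq fun c' => by
    rw [hε.symm, ← hε.comm]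
    rfl

end IsNakayamaCounit

instance {R : Type*} [Semiring R] : Module.Finite Rᵐᵒᵖ R :=
  .of_surjective (LinearMap.toSpanSingleton Rᵐᵒᵖ R 1) fun r => ⟨MulOpposite.op r, one_mul r⟩

namespace NakayamaObj

variable (K : Type u) [Field K] {A : Type u} [Ring A] [Algebra K A]
variable {X : Type u} [AddCommGroup X] [Module Aᵐᵒᵖ X]
variable {Y : Type u} [AddCommGroup Y] [Module Aᵐᵒᵖ Y]

/-- The functional `h ↦ c (h x)` on `Hom_A(X, A)`, which corresponds to `x ⊗ c` under
`D Hom_A(X, A) ≃ X ⊗ D(A)`. -/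
def tmul (x : X) : Module.Dual K A →ₗ[K] NakayamaObj K A X where
  toFun c := (toDual K A X).symm
    { toFun h := c (h x)
      map_add' h h' := by simp
      map_smul' k h := by simp }
  map_add' _ _ := rfl
  map_smul' _ _ := rfl

theorem toDual_tmul (x : X) (c : Module.Dual K A) (h : X →ₗ[Aᵐᵒᵖ] A) :
    toDual K A X (tmul K x c) h = c (h x) := rfl

theorem map_tmul (g : X →ₗ[Aᵐᵒᵖ] Y) (x : X) (c : Module.Dual K A) :
    map K A g (tmul K x c) = tmul K (g x) c := rfl

theorem op_smul_tmul (a : A) (x : X) (c : Module.Dual K A) :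
    MulOpposite.op a • tmul K x c = tmul K x (c ∘ₗ LinearMap.mulLeft K a) := rfl

theorem tmul_op_smul (a : A) (x : X) (c : Module.Dual K A) :
    tmul K (MulOpposite.op a • x) c = tmul K x (c ∘ₗ LinearMap.mulRight K a) :=
  ext fun h => by simp [toDual_tmul]

theorem tmul_add (x y : X) (c : Module.Dual K A) :
    tmul K (x + y) c = tmul K x c + tmul K y c :=
  ext fun h => by simp [toDual_tmul]

theorem zero_tmul (c : Module.Dual K A) : tmul K (0 : X) c = 0 :=
  ext fun h => by simp [toDual_tmul]

theorem map_zero_left : map K A (0 : X →ₗ[Aᵐᵒᵖ] Y) = 0 :=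
  LinearMap.ext fun n => ext fun h => by simp [toDual_map]

theorem bijective_map {g : X →ₗ[Aᵐᵒᵖ] Y}
    (hg : Function.Bijective fun h : Y →ₗ[Aᵐᵒᵖ] A => h ∘ₗ g) : Function.Bijective (map K A g) :=
  let precomp : (Y →ₗ[Aᵐᵒᵖ] A) →ₗ[K] (X →ₗ[Aᵐᵒᵖ] A) :=
    { toFun h := h ∘ₗ g
      map_add' _ _ := rfl
      map_smul' _ _ := rfl }
  LinearMap.dualMap_bijective_iff (f := precomp).2 hg

variable {K}

theorem span_tmul_eq_top [FiniteDimensional K A] [Module.Finite Aᵐᵒᵖ X] :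
    Submodule.span K {n : NakayamaObj K A X | ∃ x c, tmul K x c = n} = ⊤ := by
  have := finite_hom K A (X := X)
  refine Submodule.span_eq_top_of_ne_zero
    (s := {n : Module.Dual K (X →ₗ[Aᵐᵒᵖ] A) | ∃ x c, toDual K A X (tmul K x c) = n}) fun h hh => ?_
  contrapose! hh
  exact LinearMap.ext fun x => (Module.forall_dual_apply_eq_zero_iff K (h x)).1 fun c =>
    hh _ ⟨x, c, rfl⟩

theorem eq_top_of_tmul_mem [FiniteDimensional K A] [Module.Finite Aᵐᵒᵖ X]
    {S : Submodule Aᵐᵒᵖ (NakayamaObj K A X)} (h : ∀ x c, tmul K x c ∈ S) : S = ⊤ := by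
  rw [← Submodule.restrictScalars_eq_top_iff K, eq_top_iff, ← span_tmul_eq_top, Submodule.span_le]
  rintro _ ⟨x, c, rfl⟩
  exact h x c

theorem hom_ext_tmul [FiniteDimensional K A] [Module.Finite Aᵐᵒᵖ X]
    {u v : NakayamaObj K A X →ₗ[Aᵐᵒᵖ] Y} (h : ∀ x c, u (tmul K x c) = v (tmul K x c)) : u = v :=
  LinearMap.eqLocus_eq_top.1 (eq_top_of_tmul_mem h)

end NakayamaObj

namespace IsNakayamaCounit

open NakayamaObj

variable {K : Type u} [Field K] {A : Type u} [Ring A] [Algebra K A]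
  {ε : Module.Dual K A →ₗ[K] A} {X : Type u} [AddCommGroup X] [Module Aᵐᵒᵖ X]

section HomOfDual

variable [Module K X] [IsScalarTower K Aᵐᵒᵖ X]

/-- The homomorphism `x ↦ ε (φ (x -))` attached to a functional `φ` on `X`. -/
def homOfDual (hε : IsNakayamaCounit ε) : Module.Dual K X →ₗ[K] (X →ₗ[Aᵐᵒᵖ] A) where
  toFun φ :=
    { toFun x := ε (φ ∘ₗ (orbitMap x).restrictScalars K)
      map_add' x y := by
        rw [← map_add]
        congr 1
        ext a
        simp [orbitMap_apply]
      map_smul' a x := by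
        rw [RingHom.id_apply, ← MulOpposite.op_unop a, op_smul_eq_mul, ← hε.map_mulLeft]
        congr 1
        ext b
        simp [orbitMap_apply, mul_smul] }
  map_add' φ ψ := LinearMap.ext fun x => by simp [LinearMap.add_comp]
  map_smul' k φ := LinearMap.ext fun x => by simp [LinearMap.smul_comp]

theorem homOfDual_apply (hε : IsNakayamaCounit ε) (φ : Module.Dual K X) (x : X) :
    hε.homOfDual φ x = ε (φ ∘ₗ (orbitMap x).restrictScalars K) := rfl

theorem smul_homOfDual (hε : IsNakayamaCounit ε) (a : A) (φ : Module.Dual K X) :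
    a • hε.homOfDual φ =
      hε.homOfDual (φ ∘ₗ Module.toModuleEnd K (S := Aᵐᵒᵖ) X (MulOpposite.op a)) := by
  ext x
  rw [LinearMap.smul_apply, smul_eq_mul, homOfDual_apply, homOfDual_apply, ← hε.map_mulRight]
  congr 1
  ext b
  simp [orbitMap_apply, mul_smul]

end HomOfDual

variable [FiniteDimensional K A]

theorem exists_counit [Module.Finite Aᵐᵒᵖ X] (hε : IsNakayamaCounit ε) :
    ∃ t : NakayamaObj K A X →ₗ[Aᵐᵒᵖ] X, ∀ x c, t (tmul K x c) = MulOpposite.op (ε c) • x := by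
  let : Module K X := Module.compHom X (algebraMap K Aᵐᵒᵖ)
  have : IsScalarTower K Aᵐᵒᵖ X := .of_compHom K Aᵐᵒᵖ X
  have : FiniteDimensional K X := Module.Finite.trans Aᵐᵒᵖ X
  let t (n : NakayamaObj K A X) : X :=
    (Module.evalEquiv K X).symm (toDual K A X n ∘ₗ hε.homOfDual)
  have dual_t (n : NakayamaObj K A X) (φ : Module.Dual K X) :
      φ (t n) = toDual K A X n (hε.homOfDual φ) := by
    simp [t]
  refine ⟨{ toFun := t, map_add' := fun m n => ?_, map_smul' := fun a n => ?_ }, fun x c => ?_⟩ <;>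
    refine eq_of_forall_dual_apply_eq (K := K) fun φ => ?_
  · simp only [map_add, dual_t, LinearMap.add_apply]
  · rw [dual_t, toDual_smul, hε.smul_homOfDual, ← dual_t]
    rfl
  · exact (dual_t _ φ).trans (hε.symm _ c)

variable (X) in
/-- The extension of `ε` to the map `D Hom_A(X, A) → X` sending `x ⊗ c` to `x ε(c)`. -/
noncomputable def counit [Module.Finite Aᵐᵒᵖ X] (hε : IsNakayamaCounit ε) :
    NakayamaObj K A X →ₗ[Aᵐᵒᵖ] X :=
  hε.exists_counit.choose

variable [Module.Finite Aᵐᵒᵖ X]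

theorem counit_tmul (hε : IsNakayamaCounit ε) (x : X) (c : Module.Dual K A) :
    hε.counit X (tmul K x c) = MulOpposite.op (ε c) • x :=
  hε.exists_counit.choose_spec x c

theorem counit_naturality (hε : IsNakayamaCounit ε) {Y : Type u} [AddCommGroup Y] [Module Aᵐᵒᵖ Y]
    [Module.Finite Aᵐᵒᵖ Y] (g : X →ₗ[Aᵐᵒᵖ] Y) :
    hε.counit Y ∘ₗ map K A g = g ∘ₗ hε.counit X :=
  hom_ext_tmul fun x c => by simp [map_tmul, counit_tmul]

theorem map_counit_tmul_tmul (hε : IsNakayamaCounit ε) (x : X) (c c' : Module.Dual K A) :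
    map K A (hε.counit X) (tmul K (tmul K x c) c') =
      hε.counit (NakayamaObj K A X) (tmul K (tmul K x c) c') := by
  rw [map_tmul, counit_tmul, counit_tmul, tmul_op_smul, op_smul_tmul]
  exact congrArg _ (LinearMap.ext fun y => hε.comm c c' y)

theorem map_counit (hε : IsNakayamaCounit ε) :
    map K A (hε.counit X) = hε.counit (NakayamaObj K A X) := by
  let S : Submodule Aᵐᵒᵖ (NakayamaObj K A X) :=
    { carrier := {n | ∀ c, map K A (hε.counit X) (tmul K n c) =
        hε.counit (NakayamaObj K A X) (tmul K n c)}
      zero_mem' c := by simp only [zero_tmul, map_zero]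
      add_mem' hm hn c := by simp only [tmul_add, map_add, hm c, hn c]
      smul_mem' a n hn c := by rw [← MulOpposite.op_unop a, tmul_op_smul, hn] }
  have hS : S = ⊤ := eq_top_of_tmul_mem fun x c c' => hε.map_counit_tmul_tmul x c c'
  exact hom_ext_tmul fun n => show n ∈ S from hS ▸ Submodule.mem_top

theorem comp_counit_injective (hε : IsNakayamaCounit ε) :
    Function.Injective fun h : X →ₗ[Aᵐᵒᵖ] A => h ∘ₗ hε.counit X := fun h h' hh =>
  LinearMap.ext fun x => hε.eq_of_forall_mul_eq fun c => by
    simpa [counit_tmul] using LinearMap.congr_fun hh (tmul K x c)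

theorem comp_counit_surjective (hε : IsNakayamaCounit ε) :
    Function.Surjective fun h : X →ₗ[Aᵐᵒᵖ] A => h ∘ₗ hε.counit X := by
  intro g
  have exists_coeff (x : X) : ∃ a : A, ∀ c, g (tmul K x c) = a * ε c :=
    hε.full (g.restrictScalars K ∘ₗ tmul K x) fun a c => by
      have := g.map_smul (MulOpposite.op a) (tmul K x c)
      rwa [op_smul_tmul] at this
  choose h g_tmul using exists_coeff
  have h_add (x y : X) : h (x + y) = h x + h y := hε.eq_of_forall_mul_eq fun c => by
    rw [← g_tmul, tmul_add, map_add, g_tmul, g_tmul, add_mul]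
  have h_smul (a : Aᵐᵒᵖ) (x : X) : h (a • x) = a • h x := hε.eq_of_forall_mul_eq fun c => by
    rw [← g_tmul, ← MulOpposite.op_unop a, tmul_op_smul, g_tmul, hε.map_mulRight, ← mul_assoc]
    rfl
  refine ⟨{ toFun := h, map_add' := h_add, map_smul' := h_smul }, hom_ext_tmul fun x c => ?_⟩
  simp [counit_tmul, g_tmul, h_smul]

theorem exists_comonad (hε : IsNakayamaCounit ε) :
    ∃ G : Comonad (FGModuleCat.{u} Aᵐᵒᵖ), G.toFunctor = nakayamaFunctor K A := by
  let η : nakayamaFunctor K A ⟶ 𝟭 _ :=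
    { app X := FGModuleCat.ofHom (hε.counit X)
      naturality X Y g := FGModuleCat.hom_ext (hε.counit_naturality g.hom.hom) }
  have (X : FGModuleCat.{u} Aᵐᵒᵖ) : IsIso ((nakayamaFunctor K A).map (η.app X)) :=
    (LinearEquiv.ofBijective _ (bijective_map K (X := NakayamaObj K A X)
      ⟨hε.comp_counit_injective, hε.comp_counit_surjective⟩)).toFGModuleCatIso.isIso_hom
  exact ⟨idempotentComonad (nakayamaFunctor K A) η fun X => FGModuleCat.hom_ext hε.map_counit, rfl⟩

end IsNakayamaCounit

namespace NakayamaObj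

variable (K : Type u) [Field K] {A : Type u} [Ring A] [Algebra K A]

/-- The identification of `D(A)` with `D Hom_A(A, A)`. -/
def dualEquiv : Module.Dual K A ≃ₗ[K] NakayamaObj K A A where
  __ := tmul K (1 : A)
  invFun n := toDual K A A n ∘ₗ (LinearMap.toSpanSingleton A _ LinearMap.id).restrictScalars K
  left_inv c := LinearMap.ext fun a => by simp [toDual_tmul]
  right_inv n := ext fun h => by
    simp only [AddHom.toFun_eq_coe, LinearMap.coe_toAddHom, toDual_tmul, LinearMap.comp_apply]
    congr 1
    exact orbitMap_map_one h

theorem dualEquiv_apply (c : Module.Dual K A) : dualEquiv K c = tmul K 1 c := rfl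

theorem op_smul_dualEquiv (a : A) (c : Module.Dual K A) :
    MulOpposite.op a • dualEquiv K c = dualEquiv K (c ∘ₗ LinearMap.mulLeft K a) := rfl

variable {K}

theorem hom_ext_dualEquiv {X : Type u} [AddCommGroup X] [Module Aᵐᵒᵖ X]
    {u v : NakayamaObj K A A →ₗ[Aᵐᵒᵖ] X} (h : ∀ c, u (dualEquiv K c) = v (dualEquiv K c)) :
    u = v :=
  LinearMap.ext fun n => (dualEquiv K).apply_symm_apply n ▸ h _

theorem exists_eq_map_orbitMap [FiniteDimensional K A]
    (u : NakayamaObj K A A →ₗ[Aᵐᵒᵖ] NakayamaObj K A A) : ∃ a : A, u = map K A (orbitMap a) := by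
  obtain ⟨a, ha⟩ := (Module.evalEquiv K A).surjective
    (LinearMap.applyₗ LinearMap.id ∘ₗ (toDual K A A).toLinearMap ∘ₗ
      u.restrictScalars K ∘ₗ (dualEquiv K).toLinearMap)
  refine ⟨a, hom_ext_dualEquiv fun c => ext fun h => ?_⟩
  obtain ⟨b, rfl⟩ : ∃ b : A, b • LinearMap.id = h := ⟨h 1, orbitMap_map_one h⟩
  calc toDual K A A (u (dualEquiv K c)) (b • LinearMap.id)
      = toDual K A A (u (dualEquiv K (c ∘ₗ LinearMap.mulLeft K b))) LinearMap.id := by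
        rw [← op_smul_dualEquiv, u.map_smul, toDual_smul, MulOpposite.unop_op]
    _ = c (b * a) := (LinearMap.congr_fun ha _).symm
    _ = toDual K A A (map K A (orbitMap a) (dualEquiv K c)) (b • LinearMap.id) := by
        simp [dualEquiv_apply, map_tmul, toDual_tmul, orbitMap_apply]

section Counital

variable {K : Type u} [Field K] {A : Type u} [Ring A] [Algebra K A] [FiniteDimensional K A]
variable {X Y : Type u} [AddCommGroup X] [Module Aᵐᵒᵖ X] [Module.Finite Aᵐᵒᵖ X]
variable [AddCommGroup Y] [Module Aᵐᵒᵖ Y] [Module.Finite Aᵐᵒᵖ Y]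

variable (X) in
/-- The component at `X` of a transformation `ν ⟶ 𝟭`, as a linear map. -/
def component (η : nakayamaFunctor K A ⟶ 𝟭 (FGModuleCat.{u} Aᵐᵒᵖ)) :
    NakayamaObj K A X →ₗ[Aᵐᵒᵖ] X :=
  (η.app (FGModuleCat.of Aᵐᵒᵖ X)).hom.hom

theorem component_comp_map (η : nakayamaFunctor K A ⟶ 𝟭 (FGModuleCat.{u} Aᵐᵒᵖ))
    (g : X →ₗ[Aᵐᵒᵖ] Y) : component Y η ∘ₗ map K A g = g ∘ₗ component X η :=
  congrArg (fun f => f.hom.hom) (η.naturality (X := FGModuleCat.of Aᵐᵒᵖ X)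
    (Y := FGModuleCat.of Aᵐᵒᵖ Y) (FGModuleCat.ofHom g))

variable {η : nakayamaFunctor K A ⟶ 𝟭 (FGModuleCat.{u} Aᵐᵒᵖ)}
  {d : NakayamaObj K A A →ₗ[Aᵐᵒᵖ] NakayamaObj K A (NakayamaObj K A A)}

theorem exists_eq_orbitMap_comp_component
    (left_counit : component (NakayamaObj K A A) η ∘ₗ d = LinearMap.id)
    (f : NakayamaObj K A A →ₗ[Aᵐᵒᵖ] A) : ∃ a, f = orbitMap a ∘ₗ component A η := by
  obtain ⟨a, ha⟩ := exists_eq_map_orbitMap (map K A f ∘ₗ d)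
  refine ⟨a, ?_⟩
  calc f = f ∘ₗ component (NakayamaObj K A A) η ∘ₗ d := by rw [left_counit, LinearMap.comp_id]
    _ = component A η ∘ₗ map K A f ∘ₗ d := by
      rw [← LinearMap.comp_assoc, ← component_comp_map, LinearMap.comp_assoc]
    _ = orbitMap a ∘ₗ component A η := by rw [ha, component_comp_map]

theorem injective_map_component
    (left_counit : component (NakayamaObj K A A) η ∘ₗ d = LinearMap.id) :
    Function.Injective (map K A (component A η)) := by
  rw [injective_iff_map_eq_zero]
  refine fun n hn => ext fun f => ?_
  obtain ⟨a, rfl⟩ := exists_eq_orbitMap_comp_component left_counit f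
  rw [← toDual_map, hn]
  simp

theorem map_component_eq (left_counit : component (NakayamaObj K A A) η ∘ₗ d = LinearMap.id)
    (right_counit : map K A (component A η) ∘ₗ d = LinearMap.id) :
    map K A (component A η) = component (NakayamaObj K A A) η := by
  ext n : 1
  have d_map : d (map K A (component A η) n) = n :=
    injective_map_component left_counit (LinearMap.congr_fun right_counit _)
  calc map K A (component A η) n
      = component (NakayamaObj K A A) η (d (map K A (component A η) n)) :=
        (LinearMap.congr_fun left_counit _).symm
    _ = component (NakayamaObj K A A) η n := by rw [d_map]

theorem eq_zero_of_orbitMap_comp_component_eq_zero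
    (right_counit : map K A (component A η) ∘ₗ d = LinearMap.id) {a : A}
    (ha : orbitMap a ∘ₗ component A η = 0) : a = 0 := by
  have map_eq_zero : map K A (orbitMap a) = 0 := by
    calc map K A (orbitMap a)
        = map K A (orbitMap a) ∘ₗ map K A (component A η) ∘ₗ d := by
          rw [right_counit, LinearMap.comp_id]
      _ = map K A (orbitMap a ∘ₗ component A η) ∘ₗ d := rfl
      _ = 0 := by rw [ha, map_zero_left, LinearMap.zero_comp]
  refine (Module.forall_dual_apply_eq_zero_iff K a).1 fun c => ?_
  simpa [map_tmul, toDual_tmul, orbitMap_apply] using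
    congr(toDual K A A ($map_eq_zero (tmul K 1 c)) LinearMap.id)

theorem isNakayamaCounit_component
    (left_counit : component (NakayamaObj K A A) η ∘ₗ d = LinearMap.id)
    (right_counit : map K A (component A η) ∘ₗ d = LinearMap.id) :
    IsNakayamaCounit
      ((component A η).restrictScalars K ∘ₗ (dualEquiv K).toLinearMap) where
  comm c c' x := by
    have h := LinearMap.congr_fun (component_comp_map η (orbitMap (dualEquiv K c)))
      (dualEquiv K c')
    rw [← map_component_eq left_counit right_counit] at h
    simpa [dualEquiv_apply, map_tmul, orbitMap_apply, op_smul_tmul, toDual_tmul] using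
      congr(toDual K A A $h (orbitMap x))
  faithful a ha := eq_zero_of_orbitMap_comp_component_eq_zero right_counit
    (hom_ext_dualEquiv ha)
  full f hf := by
    obtain ⟨a, ha⟩ := exists_eq_orbitMap_comp_component left_counit
      { __ := f ∘ₗ (dualEquiv K).symm.toLinearMap
        map_smul' b n := by
          obtain ⟨c, rfl⟩ := (dualEquiv K).surjective n
          rw [← MulOpposite.op_unop b, op_smul_dualEquiv]
          simp [hf] }
    exact ⟨a, fun c => by simpa [orbitMap_apply] using LinearMap.congr_fun ha (dualEquiv K c)⟩

end Counital

end NakayamaObj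

theorem exists_isNakayamaCounit_of_comonad {K A : Type u} [Field K] [Ring A]
    [Algebra K A] [FiniteDimensional K A] {G : Comonad (FGModuleCat.{u} Aᵐᵒᵖ)}
    (hG : G.toFunctor = nakayamaFunctor K A) :
    ∃ ε : Module.Dual K A →ₗ[K] A, IsNakayamaCounit ε := by
  cases G with | mk F η δ _ left_counit right_counit => ?_
  dsimp only at hG
  subst hG
  exact ⟨_, NakayamaObj.isNakayamaCounit_component (η := η)
    (d := (δ.app (FGModuleCat.of Aᵐᵒᵖ A)).hom.hom)
    (congrArg (fun f => f.hom.hom) (left_counit (FGModuleCat.of Aᵐᵒᵖ A)))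
    (congrArg (fun f => f.hom.hom) (right_counit (FGModuleCat.of Aᵐᵒᵖ A)))⟩

section SymmetrizingForm

/-- A symmetrizing form on an algebra: a linear form `τ` such that `(x, y) ↦ τ (x * y)` is symmetric
and nondegenerate. -/
structure IsSymmetrizingForm {K B : Type*} [CommSemiring K] [Semiring B] [Algebra K B]
    (τ : Module.Dual K B) : Prop where
  map_mul_comm : ∀ x y, τ (x * y) = τ (y * x)
  eq_zero_of_forall : ∀ x, (∀ y, τ (x * y) = 0) → x = 0

namespace IsSymmetrizingForm

variable {K B : Type*} [Field K] [Ring B] [Algebra K B] {τ : Module.Dual K B}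

theorem eq_of_forall (hτ : IsSymmetrizingForm τ) {x y : B} (h : ∀ z, τ (x * z) = τ (y * z)) :
    x = y :=
  sub_eq_zero.1 (hτ.eq_zero_of_forall _ fun z => by rw [sub_mul, map_sub, h, sub_self])

/-- The isomorphism `x ↦ τ (x * -)` from `B` to its dual. -/
noncomputable def toDual [FiniteDimensional K B] (hτ : IsSymmetrizingForm τ) :
    B ≃ₗ[K] Module.Dual K B :=
  ((LinearMap.mul K B).compr₂ τ).linearEquivOfInjective
    (fun _ _ h => hτ.eq_of_forall (LinearMap.congr_fun h)) Subspace.dual_finrank_eq.symm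

theorem toDual_apply [FiniteDimensional K B] (hτ : IsSymmetrizingForm τ) (x y : B) :
    hτ.toDual x y = τ (x * y) := rfl

end IsSymmetrizingForm

theorem isSymmetricAlg_iff {K B : Type u} [Field K] [Ring B] [Algebra K B] :
    IsSymmetricAlg K B ↔ FiniteDimensional K B ∧ ∃ τ : Module.Dual K B, IsSymmetrizingForm τ := by
  refine and_congr_right fun _ => ⟨fun ⟨φ, hφ⟩ => ?_, fun ⟨τ, hτ⟩ => ⟨hτ.toDual, fun b y c x => ?_⟩⟩
  · have map_eq_mul (y x : B) : φ y x = φ 1 (y * x) := by simpa using hφ 1 1 y x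
    have map_eq_mul' (y x : B) : φ y x = φ 1 (x * y) := by simpa using hφ y 1 1 x
    refine ⟨φ 1, fun x y => by rw [← map_eq_mul, ← map_eq_mul'], fun x h => ?_⟩
    exact φ.map_eq_zero_iff.1 (LinearMap.ext fun y => (map_eq_mul x y).trans (h y))
  · rw [hτ.toDual_apply, hτ.toDual_apply, mul_assoc, mul_assoc, hτ.map_mul_comm]
    simp only [mul_assoc]

end SymmetrizingForm

theorem isRightGenerator_iff {B M : Type u} [Ring B] [AddCommGroup M] [Module Bᵐᵒᵖ M] :
    IsRightGenerator B M ↔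
      ∃ (n : ℕ) (p : Fin n → M →ₗ[Bᵐᵒᵖ] B) (m : Fin n → M), ∑ j, p j (m j) = 1 := by
  constructor
  · rintro ⟨n, i, p, hpi⟩
    refine ⟨n, fun j => p ∘ₗ LinearMap.single Bᵐᵒᵖ (fun _ => M) j, i 1, ?_⟩
    simp only [LinearMap.comp_apply, ← map_sum, LinearMap.coe_single, Finset.univ_sum_single]
    exact LinearMap.congr_fun hpi 1
  · rintro ⟨n, p, m, hpm⟩
    refine ⟨n, LinearMap.pi fun j => orbitMap (m j), ∑ j, p j ∘ₗ LinearMap.proj j, ?_⟩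
    ext
    simp [orbitMap_apply, hpm]

section Endomorphisms

variable {K B M : Type*} [Field K] [Ring B] [Algebra K B]
variable [AddCommGroup M] [Module K M] [Module Bᵐᵒᵖ M] [IsScalarTower K Bᵐᵒᵖ M]

variable (K) in
/-- The endomorphism `x ↦ m s(x)` of a right module determined by an element `m` and a linear
form `s`. -/
def rankOne (m : M) : (M →ₗ[Bᵐᵒᵖ] B) →ₗ[K] Module.End Bᵐᵒᵖ M where
  toFun s := orbitMap m ∘ₗ s
  map_add' s s' := LinearMap.comp_add s s' _
  map_smul' k s := LinearMap.ext fun x => by simp [orbitMap_apply]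

theorem rankOne_apply (m : M) (s : M →ₗ[Bᵐᵒᵖ] B) (x : M) :
    rankOne K m s x = MulOpposite.op (s x) • m := rfl

theorem mul_rankOne (a : Module.End Bᵐᵒᵖ M) (m : M) (s : M →ₗ[Bᵐᵒᵖ] B) :
    a * rankOne K m s = rankOne K (a m) s :=
  LinearMap.ext fun x => by simp [rankOne_apply]

theorem rankOne_add (m m' : M) (s : M →ₗ[Bᵐᵒᵖ] B) :
    rankOne K (m + m') s = rankOne K m s + rankOne K m' s :=
  LinearMap.ext fun x => by simp [rankOne_apply]

theorem rankOne_op_smul (b : B) (m : M) (s : M →ₗ[Bᵐᵒᵖ] B) :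
    rankOne K (MulOpposite.op b • m) s = rankOne K m (b • s) :=
  LinearMap.ext fun x => by simp [rankOne_apply, mul_smul]

theorem sum_rankOne_apply {ι : Type*} [Fintype ι] {p : ι → M →ₗ[Bᵐᵒᵖ] B} {m : ι → M}
    (hpm : ∑ j, p j (m j) = 1) (x : M) : ∑ j, rankOne K x (p j) (m j) = x :=
  calc
    ∑ j, orbitMap x (p j (m j)) = orbitMap x 1 := by rw [← map_sum, hpm]
    _ = x := orbitMap_apply_one x

/-- The matrix coefficient `a ↦ τ (s (a m))` on the endomorphism ring of a right module. -/
def coeff (τ : Module.Dual K B) (m : M) (s : M →ₗ[Bᵐᵒᵖ] B) :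
    Module.Dual K (Module.End Bᵐᵒᵖ M) where
  toFun a := τ (s (a m))
  map_add' a b := by simp
  map_smul' k a := by simp [LinearMap.map_smul_of_tower]

theorem coeff_apply (τ : Module.Dual K B) (m : M) (s : M →ₗ[Bᵐᵒᵖ] B) (a : Module.End Bᵐᵒᵖ M) :
    coeff τ m s a = τ (s (a m)) := rfl

theorem coeff_add (τ : Module.Dual K B) (m m' : M) (s : M →ₗ[Bᵐᵒᵖ] B) :
    coeff τ (m + m') s = coeff τ m s + coeff τ m' s :=
  LinearMap.ext fun a => by simp [coeff_apply]

namespace IsSymmetrizingForm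

variable {τ : Module.Dual K B}

theorem coeff_comp_rankOne (hτ : IsSymmetrizingForm τ) (m x : M) (s p : M →ₗ[Bᵐᵒᵖ] B) :
    coeff τ m (s ∘ₗ rankOne K x p) = coeff τ (MulOpposite.op (s x) • m) p :=
  LinearMap.ext fun a => by simp [coeff_apply, rankOne_apply, hτ.map_mul_comm]

theorem coeff_rankOne_comm (hτ : IsSymmetrizingForm τ) (m x : M) (s p : M →ₗ[Bᵐᵒᵖ] B) :
    coeff τ m s (rankOne K x p) = coeff τ x p (rankOne K m s) := by
  simp [coeff_apply, rankOne_apply, hτ.map_mul_comm]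

theorem injective_comp (hτ : IsSymmetrizingForm τ) :
    Function.Injective fun s : M →ₗ[Bᵐᵒᵖ] B => τ ∘ₗ s.restrictScalars K := fun s s' h =>
  LinearMap.ext fun m => hτ.eq_of_forall fun b => by
    simpa using LinearMap.congr_fun h (MulOpposite.op b • m)

theorem map_coeff_rankOne_apply (hτ : IsSymmetrizingForm τ)
    {f : Module.Dual K (Module.End Bᵐᵒᵖ M) →ₗ[K] Module.End Bᵐᵒᵖ M}
    (hf : ∀ a c, f (c ∘ₗ LinearMap.mulLeft K a) = f c * a) (x y z : M) (s t : M →ₗ[Bᵐᵒᵖ] B) :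
    f (coeff τ x s) (rankOne K y t z) = f (coeff τ (rankOne K x s y) t) z := by
  rw [← Module.End.mul_apply, ← hf, rankOne_apply, ← hτ.coeff_comp_rankOne]
  rfl

variable [FiniteDimensional K B]

theorem surjective_comp (hτ : IsSymmetrizingForm τ) :
    Function.Surjective fun s : M →ₗ[Bᵐᵒᵖ] B => τ ∘ₗ s.restrictScalars K := by
  intro ψ
  have mul_symm (m : M) (b : B) :
      τ (hτ.toDual.symm (ψ ∘ₗ (orbitMap m).restrictScalars K) * b) = ψ (MulOpposite.op b • m) := by
    rw [← hτ.toDual_apply, LinearEquiv.apply_symm_apply]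
    rfl
  refine ⟨{ toFun := fun m => hτ.toDual.symm (ψ ∘ₗ (orbitMap m).restrictScalars K)
            map_add' := fun m m' => hτ.eq_of_forall fun b => ?_
            map_smul' := fun a m => hτ.eq_of_forall fun b => ?_ }, LinearMap.ext fun m => ?_⟩
  · simp only [add_mul, map_add, mul_symm, smul_add]
  · rw [RingHom.id_apply, ← MulOpposite.op_unop a, op_smul_eq_mul, mul_assoc, mul_symm, mul_symm,
      MulOpposite.op_mul, mul_smul]
  · simpa using mul_symm m 1

/-- The isomorphism `s ↦ τ ∘ s` between the `B`-dual and the `K`-dual of a right module. -/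
noncomputable def homEquivDual (hτ : IsSymmetrizingForm τ) :
    (M →ₗ[Bᵐᵒᵖ] B) ≃ₗ[K] Module.Dual K M :=
  .ofBijective
    { toFun s := τ ∘ₗ s.restrictScalars K
      map_add' s s' := LinearMap.ext fun m => by simp
      map_smul' k s := LinearMap.ext fun m => by simp }
    ⟨hτ.injective_comp, hτ.surjective_comp⟩

variable [FiniteDimensional K M]

/-- The isomorphism from a right module to the `K`-dual of its `B`-dual that sends `m` to
`s ↦ τ (s m)`. -/
noncomputable def evalHomEquiv (hτ : IsSymmetrizingForm τ) :
    M ≃ₗ[K] Module.Dual K (M →ₗ[Bᵐᵒᵖ] B) :=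
  Module.evalEquiv K M ≪≫ₗ hτ.homEquivDual.dualMap

theorem apply_evalHomEquiv_symm (hτ : IsSymmetrizingForm τ) (ψ : Module.Dual K (M →ₗ[Bᵐᵒᵖ] B))
    (s : M →ₗ[Bᵐᵒᵖ] B) : τ (s (hτ.evalHomEquiv.symm ψ)) = ψ s :=
  LinearMap.congr_fun (hτ.evalHomEquiv.apply_symm_apply ψ) s

theorem ext_of_forall_comp (hτ : IsSymmetrizingForm τ) {m m' : M}
    (h : ∀ s : M →ₗ[Bᵐᵒᵖ] B, τ (s m) = τ (s m')) : m = m' :=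
  hτ.evalHomEquiv.injective (LinearMap.ext h)

theorem span_coeff_eq_top (hτ : IsSymmetrizingForm τ) :
    Submodule.span K {c : Module.Dual K (Module.End Bᵐᵒᵖ M) | ∃ m s, coeff τ m s = c} = ⊤ := by
  have : FiniteDimensional K (Module.End Bᵐᵒᵖ M) :=
    .of_injective (LinearMap.restrictScalarsₗ K Bᵐᵒᵖ M M K) (LinearMap.restrictScalars_injective K)
  refine Submodule.span_eq_top_of_ne_zero fun a ha => ?_
  contrapose! ha
  exact LinearMap.ext fun m => hτ.ext_of_forall_comp fun s => by
    simpa [coeff_apply] using ha _ ⟨m, s, rfl⟩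

theorem hom_ext_coeff (hτ : IsSymmetrizingForm τ) {W : Type*} [AddCommGroup W] [Module K W]
    {f g : Module.Dual K (Module.End Bᵐᵒᵖ M) →ₗ[K] W}
    (h : ∀ m s, f (coeff τ m s) = g (coeff τ m s)) : f = g :=
  LinearMap.ext_on hτ.span_coeff_eq_top fun _ ⟨m, s, hc⟩ => hc ▸ h m s

/-- The map `ε : D(End_B(M)) → End_B(M)` characterised by `τ (s (ε c m)) = c (rankOne m s)`. -/
noncomputable def endCounit (hτ : IsSymmetrizingForm τ) :
    Module.Dual K (Module.End Bᵐᵒᵖ M) →ₗ[K] Module.End Bᵐᵒᵖ M where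
  toFun c :=
    { toFun m := hτ.evalHomEquiv.symm (c ∘ₗ rankOne K m)
      map_add' m m' := hτ.ext_of_forall_comp fun s => by
        simp only [map_add, hτ.apply_evalHomEquiv_symm, LinearMap.comp_apply, rankOne_add]
      map_smul' b m := hτ.ext_of_forall_comp fun s => by
        rw [RingHom.id_apply, ← MulOpposite.op_unop b, map_smul, op_smul_eq_mul, hτ.map_mul_comm,
          ← smul_eq_mul, ← LinearMap.smul_apply]
        simp only [hτ.apply_evalHomEquiv_symm, LinearMap.comp_apply, rankOne_op_smul] }
  map_add' c c' := LinearMap.ext fun m => by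
    simp only [LinearMap.add_comp, map_add]
    rfl
  map_smul' k c := LinearMap.ext fun m => by
    simp only [LinearMap.smul_comp, map_smul]
    rfl

theorem apply_endCounit (hτ : IsSymmetrizingForm τ) (c : Module.Dual K (Module.End Bᵐᵒᵖ M))
    (s : M →ₗ[Bᵐᵒᵖ] B) (m : M) : τ (s (hτ.endCounit c m)) = c (rankOne K m s) :=
  hτ.apply_evalHomEquiv_symm _ s

theorem endCounit_coeff (hτ : IsSymmetrizingForm τ) (m : M) (s : M →ₗ[Bᵐᵒᵖ] B) :
    hτ.endCounit (coeff τ m s) = rankOne K m s :=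
  LinearMap.ext fun x => hτ.ext_of_forall_comp fun p => by
    rw [apply_endCounit, hτ.coeff_rankOne_comm, coeff_apply]

theorem endCounit_comm (hτ : IsSymmetrizingForm τ) (c c' : Module.Dual K (Module.End Bᵐᵒᵖ M))
    (x : Module.End Bᵐᵒᵖ M) : c' (x * hτ.endCounit c) = c (hτ.endCounit c' * x) := by
  have eval_eq : Module.Dual.eval K _ (x * hτ.endCounit c) =
      c ∘ₗ LinearMap.mulRight K x ∘ₗ hτ.endCounit :=
    hτ.hom_ext_coeff fun m s => by
      simp only [LinearMap.comp_apply, endCounit_coeff]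
      exact hτ.apply_endCounit c (s ∘ₗ x) m
  exact LinearMap.congr_fun eval_eq c'

section Generator

variable {ι : Type*} [Fintype ι] {p : ι → M →ₗ[Bᵐᵒᵖ] B} {m : ι → M}

theorem endCounit_faithful (hτ : IsSymmetrizingForm τ) (hpm : ∑ j, p j (m j) = 1)
    {a : Module.End Bᵐᵒᵖ M} (ha : ∀ c, a * hτ.endCounit c = 0) : a = 0 := by
  have rankOne_eq_zero (x : M) (s : M →ₗ[Bᵐᵒᵖ] B) : rankOne K (a x) s = 0 := by
    rw [← mul_rankOne, ← hτ.endCounit_coeff, ha]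
  exact LinearMap.ext fun x => by
    rw [← sum_rankOne_apply (K := K) hpm (a x)]
    simp [rankOne_eq_zero]

theorem endCounit_full (hτ : IsSymmetrizingForm τ) (hpm : ∑ j, p j (m j) = 1)
    (f : Module.Dual K (Module.End Bᵐᵒᵖ M) →ₗ[K] Module.End Bᵐᵒᵖ M)
    (hf : ∀ a c, f (c ∘ₗ LinearMap.mulLeft K a) = f c * a) :
    ∃ a, ∀ c, f c = a * hτ.endCounit c := by
  let a (x : M) : M := ∑ j, f (coeff τ x (p j)) (m j)
  have f_coeff (x y : M) (s : M →ₗ[Bᵐᵒᵖ] B) : f (coeff τ x s) y = a (rankOne K x s y) :=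
    calc
      f (coeff τ x s) y = ∑ j, f (coeff τ x s) (rankOne K y (p j) (m j)) := by
        rw [← map_sum, sum_rankOne_apply hpm]
      _ = a (rankOne K x s y) :=
        Finset.sum_congr rfl fun j _ => hτ.map_coeff_rankOne_apply hf x y (m j) s (p j)
  have a_add (x y : M) : a (x + y) = a x + a y := by
    simp only [a, coeff_add, map_add, LinearMap.add_apply, Finset.sum_add_distrib]
  have a_sum (x : ι → M) : a (∑ j, x j) = ∑ j, a (x j) := map_sum (AddMonoidHom.mk' a a_add) _ _
  have a_smul (b : Bᵐᵒᵖ) (x : M) : a (b • x) = b • a x :=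
    calc
      a (b • x) = a (∑ j, rankOne K x (p j) (b • m j)) := by
        simp only [map_smul, ← Finset.smul_sum, sum_rankOne_apply hpm]
      _ = ∑ j, f (coeff τ x (p j)) (b • m j) := by simp only [a_sum, f_coeff]
      _ = b • a x := by simp only [map_smul, a, Finset.smul_sum]
  let a' : Module.End Bᵐᵒᵖ M := ⟨⟨a, a_add⟩, a_smul⟩
  have f_eq : f = LinearMap.mulLeft K a' ∘ₗ hτ.endCounit :=
    hτ.hom_ext_coeff fun x s => LinearMap.ext fun y => by
      rw [f_coeff, LinearMap.comp_apply, endCounit_coeff]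
      rfl
  exact ⟨a', LinearMap.congr_fun f_eq⟩

theorem isNakayamaCounit_endCounit (hτ : IsSymmetrizingForm τ) (hpm : ∑ j, p j (m j) = 1) :
    IsNakayamaCounit (hτ.endCounit (M := M)) where
  comm := hτ.endCounit_comm
  faithful _ := hτ.endCounit_faithful hpm
  full := hτ.endCounit_full hpm

end Generator

end IsSymmetrizingForm

end Endomorphisms

theorem IsNakayamaCounit.of_algEquiv {K A A' : Type*} [CommRing K] [Ring A] [Algebra K A] [Ring A']
    [Algebra K A'] {ε : Module.Dual K A →ₗ[K] A} (hε : IsNakayamaCounit ε) (α : A ≃ₐ[K] A') :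
    IsNakayamaCounit (α.toLinearMap ∘ₗ ε ∘ₗ α.toLinearEquiv.dualMap.toLinearMap) where
  comm c c' x := by
    simpa using hε.comm (α.toLinearEquiv.dualMap c) (α.toLinearEquiv.dualMap c') (α.symm x)
  faithful a ha := by
    refine (map_eq_zero_iff α.symm α.symm.injective).1 (hε.faithful _ fun c => ?_)
    obtain ⟨c, rfl⟩ := α.toLinearEquiv.dualMap.surjective c
    simpa using congrArg α.symm (ha c)
  full f hf := by
    obtain ⟨a, ha⟩ := hε.full
      (α.symm.toLinearMap ∘ₗ f ∘ₗ α.toLinearEquiv.dualMap.symm.toLinearMap) fun a c => by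
        obtain ⟨c, rfl⟩ := α.toLinearEquiv.dualMap.surjective c
        have h : α.toLinearEquiv.dualMap c ∘ₗ LinearMap.mulLeft K a =
            α.toLinearEquiv.dualMap (c ∘ₗ LinearMap.mulLeft K (α a)) :=
          LinearMap.ext fun x => by simp
        simp [h, hf, -LinearEquiv.dualMap_symm]
    exact ⟨α a, fun c => by
      simpa [-LinearEquiv.dualMap_symm] using congrArg α (ha (α.toLinearEquiv.dualMap c))⟩

theorem IsGendoSymmetric.exists_isNakayamaCounit {K A : Type u} [Field K] [Ring A] [Algebra K A]
    (hA : IsGendoSymmetric K A) : ∃ ε : Module.Dual K A →ₗ[K] A, IsNakayamaCounit ε := by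
  obtain ⟨B, _, _, M, _, _, _, _, hB, _, hM, ⟨α⟩⟩ := hA
  obtain ⟨_, τ, hτ⟩ := isSymmetricAlg_iff.1 hB
  obtain ⟨n, p, m, hpm⟩ := isRightGenerator_iff.1 hM
  exact ⟨_, (hτ.isNakayamaCounit_endCounit hpm).of_algEquiv α.symm⟩

section IdempotentIdeals

variable {R : Type*} [Ring R]

theorem ideal_le_of_le_sup_of_isNilpotent {I J L : Ideal R} [L.IsTwoSided]
    (hI : IsIdempotentElem I) (hJ : IsNilpotent J) (h : I ≤ L ⊔ J) : I ≤ L := by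
  obtain ⟨n, hn⟩ := hJ
  suffices le_sup_pow : ∀ k, I ≤ L ⊔ J ^ k by
    simpa only [hn, Submodule.zero_eq_bot, sup_bot_eq] using le_sup_pow n
  intro k
  induction k with
  | zero => simp only [Submodule.pow_zero, Ideal.one_eq_top, sup_top_eq, le_top]
  | succ k ih =>
    calc
      I = I * I := hI.symm
      _ ≤ (L ⊔ J ^ k) * (L ⊔ J) := Ideal.mul_mono ih h
      _ = (L ⊔ J ^ k) * L ⊔ (L * J ⊔ J ^ k * J) := by rw [Ideal.mul_sup, Ideal.sup_mul _ _ J]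
      _ ≤ L ⊔ J ^ (k + 1) :=
        sup_le (le_sup_of_le_left Ideal.mul_le_right) (sup_le_sup Ideal.mul_le_left le_rfl)

theorem isNilpotent_of_mem_of_isNilpotent {I : Ideal R} (hI : IsNilpotent I) {x : R} (hx : x ∈ I) :
    IsNilpotent x :=
  hI.imp fun n hn => by simpa [hn] using Ideal.pow_mem_pow hx n

theorem mem_of_isIdempotentElem_of_isNilpotent_sub {I : Ideal R} [I.IsTwoSided] {e x : R}
    (he : IsIdempotentElem e) (hx : x ∈ I) (hex : IsNilpotent (e - x)) : e ∈ I := by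
  obtain ⟨n, hn⟩ := hex
  rw [← Ideal.Quotient.eq_zero_iff_mem] at hx ⊢
  calc
    Ideal.Quotient.mk I e = Ideal.Quotient.mk I e ^ (n + 1) :=
      ((he.map (Ideal.Quotient.mk I)).pow_succ_eq n).symm
    _ = Ideal.Quotient.mk I ((e - x) ^ (n + 1)) := by rw [map_pow, map_sub, hx, sub_zero]
    _ = 0 := by rw [pow_succ, hn, zero_mul, map_zero]

theorem exists_isIdempotentElem_eq_span_mul_top [IsSemiprimaryRing R] {I : Ideal R}
    [I.IsTwoSided] (hI : IsIdempotentElem I) :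
    ∃ e ∈ I, IsIdempotentElem e ∧ I = Ideal.span {e} * ⊤ := by
  let π := Ideal.Quotient.mk (Ring.jacobson R)
  have hπ : Function.Surjective π := Ideal.Quotient.mk_surjective
  have isNilpotent_of_mem {x : R} : x ∈ Ring.jacobson R → IsNilpotent x :=
    isNilpotent_of_mem_of_isNilpotent IsSemiprimaryRing.isNilpotent
  have := IsSemiprimaryRing.isSemisimpleRing (R := R)
  obtain ⟨f, hf, hIf⟩ := IsSemisimpleRing.ideal_eq_span_idempotent (I.map π)
  obtain ⟨e, he, rfl⟩ := exists_isIdempotentElem_eq_of_ker_isNilpotent π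
    (fun x hx => isNilpotent_of_mem (Ideal.Quotient.eq_zero_iff_mem.1 hx)) f (hπ f) hf
  obtain ⟨x, hx, hxe⟩ : ∃ x ∈ I, π x = π e :=
    (Ideal.mem_map_iff_of_surjective π hπ).1 (hIf ▸ Ideal.mem_span_singleton_self _)
  have he_mem : e ∈ I := mem_of_isIdempotentElem_of_isNilpotent_sub he hx
    (isNilpotent_of_mem (Ideal.Quotient.eq.1 hxe.symm))
  refine ⟨e, he_mem, he, le_antisymm ?_ ?_⟩
  · refine ideal_le_of_le_sup_of_isNilpotent hI IsSemiprimaryRing.isNilpotent fun y hy => ?_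
    obtain ⟨r, hr⟩ := Ideal.mem_span_singleton'.1 (hIf ▸ Ideal.mem_map_of_mem π hy)
    obtain ⟨r, rfl⟩ := hπ r
    have span_le : Ideal.span {e} ≤ Ideal.span {e} * ⊤ := by
      rw [Ideal.span_singleton_le_iff_mem]
      simpa using Ideal.mul_mem_mul (Ideal.mem_span_singleton_self e) (Submodule.mem_top (x := 1))
    rw [← map_mul] at hr
    rw [← add_sub_cancel (r * e) y]
    exact add_mem
      (Ideal.mem_sup_left (span_le (Ideal.mul_mem_left _ r (Ideal.mem_span_singleton_self e))))
      (Ideal.mem_sup_right (Ideal.Quotient.eq.1 hr.symm))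
  · calc
      Ideal.span {e} * ⊤ ≤ I * ⊤ :=
        Ideal.mul_mono_left ((Ideal.span_singleton_le_iff_mem I).2 he_mem)
      _ = I := I.mul_top

end IdempotentIdeals

section TraceIdeal

variable {A M : Type*} [Ring A] [AddCommGroup M] [Module A M]

variable (A M) in
/-- The trace ideal of a left `A`-module `M`: the sum of the images of all linear maps `M → A`. -/
def traceIdeal : Ideal A := ⨆ φ : M →ₗ[A] A, LinearMap.range φ

theorem mul_eq_zero_of_mem_traceIdeal {a : A} (ha : ∀ m : M, a • m = 0) {u : A}
    (hu : u ∈ traceIdeal A M) : a * u = 0 := by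
  induction hu using Submodule.iSup_induction' with
  | mem φ x hx =>
    obtain ⟨m, rfl⟩ := hx
    rw [← smul_eq_mul, ← map_smul, ha, map_zero]
  | zero => rw [mul_zero]
  | add x y _ _ hx hy => rw [mul_add, hx, hy, add_zero]

theorem doubleCentralizer_map_smul (g : Module.End (Module.End A M) M) (φ : M →ₗ[A] A) (m m' : M) :
    g (φ m • m') = φ (g m) • m' :=
  g.map_smul (φ.smulRight m') m

theorem exists_forall_smul_eq_of_mem_traceIdeal (g : Module.End (Module.End A M) M) {u : A}
    (hu : u ∈ traceIdeal A M) : ∃ v : A, ∀ m : M, v • m = g (u • m) := by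
  induction hu using Submodule.iSup_induction' with
  | mem φ x hx =>
    obtain ⟨m, rfl⟩ := hx
    exact ⟨φ (g m), fun m' => (doubleCentralizer_map_smul g φ m m').symm⟩
  | zero => exact ⟨0, fun m => by simp⟩
  | add x y _ _ hx hy =>
    obtain ⟨v, hv⟩ := hx
    obtain ⟨w, hw⟩ := hy
    exact ⟨v + w, fun m => by rw [add_smul, hv, hw, add_smul, map_add]⟩

end TraceIdeal

namespace IsNakayamaCounit

section DoubleCentralizer

variable {K A M : Type*} [CommRing K] [Ring A] [Algebra K A] {ε : Module.Dual K A →ₗ[K] A}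
variable [AddCommGroup M] [Module A M]

theorem eq_of_forall_smul_eq (hε : IsNakayamaCounit ε) (hM : ∀ c, ε c ∈ traceIdeal A M) {a b : A}
    (h : ∀ m : M, a • m = b • m) : a = b :=
  sub_eq_zero.1 <| hε.faithful _ fun c => mul_eq_zero_of_mem_traceIdeal
    (fun m => by rw [sub_smul, h, sub_self]) (hM c)

variable [Module K M] [IsScalarTower K A M]

theorem exists_map_smul_eq [Module.Projective K A] (hε : IsNakayamaCounit ε)
    (hM : ∀ c, ε c ∈ traceIdeal A M) (g : Module.End (Module.End A M) M) :
    ∃ a : A, ∀ c (m : M), g (ε c • m) = a • ε c • m := by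
  choose v hv using fun c => exists_forall_smul_eq_of_mem_traceIdeal g (hM c)
  have ext {a b : A} : (∀ m : M, a • m = b • m) → a = b := hε.eq_of_forall_smul_eq hM
  let f : Module.Dual K A →ₗ[K] A :=
    { toFun := v
      map_add' c c' := ext fun m => by simp [add_smul, hv]
      map_smul' k c := ext fun m => by
        rw [RingHom.id_apply, smul_assoc k (v c), hv, hv, map_smul ε, smul_assoc k (ε c),
            LinearMap.map_smul_of_tower] }
  obtain ⟨a, ha⟩ := hε.full f fun a c => ext fun m => by
    change v _ • m = (v c * a) • m
    rw [hv, hε.map_mulLeft, mul_smul, mul_smul, hv]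
  exact ⟨a, fun c m => by rw [← mul_smul, ← ha, ← hv]; rfl⟩

theorem bijective_lsmul [Module.Projective K A] (hε : IsNakayamaCounit ε)
    (hM : ∀ c, ε c ∈ traceIdeal A M) (hM' : ∀ m : M, ∃ c m', ε c • m' = m) :
    Function.Bijective (Algebra.lsmul K (Module.End A M) M : A →ₐ[K] _) := by
  refine ⟨fun a b h => hε.eq_of_forall_smul_eq hM (LinearMap.congr_fun h), fun g => ?_⟩
  obtain ⟨a, ha⟩ := hε.exists_map_smul_eq hM g
  refine ⟨a, LinearMap.ext fun m => ?_⟩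
  obtain ⟨c, m, rfl⟩ := hM' m
  exact (ha c m).symm

end DoubleCentralizer

section RangeIdeal

variable {K A : Type*} [Field K] [Ring A] [Algebra K A] {ε : Module.Dual K A →ₗ[K] A}

/-- The image of `ε`, as a two-sided ideal. -/
def rangeIdeal (hε : IsNakayamaCounit ε) : Ideal A where
  __ := (LinearMap.range ε).toAddSubmonoid
  smul_mem' := by
    rintro a _ ⟨c, rfl⟩
    exact ⟨c ∘ₗ LinearMap.mulRight K a, hε.map_mulRight a c⟩

theorem mem_rangeIdeal (hε : IsNakayamaCounit ε) {a : A} : a ∈ hε.rangeIdeal ↔ ∃ c, ε c = a :=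
  Iff.rfl

instance (hε : IsNakayamaCounit ε) : hε.rangeIdeal.IsTwoSided where
  mul_mem_of_left := by
    rintro _ a ⟨c, rfl⟩
    exact ⟨c ∘ₗ LinearMap.mulLeft K a, hε.map_mulLeft a c⟩

variable [FiniteDimensional K A]

theorem span_comp_mulRight_eq_top (hε : IsNakayamaCounit ε) :
    Submodule.span K {d : Module.Dual K A | ∃ c c', c ∘ₗ LinearMap.mulRight K (ε c') = d} = ⊤ := by
  refine Submodule.span_eq_top_of_ne_zero fun a ha => ?_
  contrapose! ha
  exact hε.faithful a fun c' => (Module.forall_dual_apply_eq_zero_iff K _).1 fun c =>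
    ha _ ⟨c, c', rfl⟩

theorem isIdempotentElem_rangeIdeal (hε : IsNakayamaCounit ε) :
    IsIdempotentElem hε.rangeIdeal := by
  refine le_antisymm Ideal.mul_le_right ?_
  have top_le : ⊤ ≤ ((hε.rangeIdeal * hε.rangeIdeal).restrictScalars K).comap ε := by
    rw [← hε.span_comp_mulRight_eq_top, Submodule.span_le]
    rintro _ ⟨c, c', rfl⟩
    change ε _ ∈ hε.rangeIdeal * hε.rangeIdeal
    rw [hε.map_mulRight]
    exact Ideal.mul_mem_mul ⟨c', rfl⟩ ⟨c, rfl⟩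
  rintro _ ⟨c, rfl⟩
  exact top_le Submodule.mem_top

end RangeIdeal

end IsNakayamaCounit

section SpanIdempotent

variable {A : Type*} [Ring A] {e : A}

variable (e) in
/-- The element `e`, as the generator of the left module `A e`. -/
def spanSelf : Ideal.span {e} := ⟨e, Ideal.mem_span_singleton_self e⟩

theorem smul_spanSelf (he : IsIdempotentElem e) (m : Ideal.span {e}) :
    (m : A) • spanSelf e = m := by
  obtain ⟨_, hm⟩ := m
  obtain ⟨a, rfl⟩ := Ideal.mem_span_singleton'.1 hm
  exact Subtype.ext (by simp [spanSelf, mul_assoc, he.eq])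

theorem coe_mul_eq_of_mem_span (he : IsIdempotentElem e) (m : Ideal.span {e}) : (m : A) * e = m :=
  congrArg Subtype.val (smul_spanSelf he m)

theorem end_span_apply (he : IsIdempotentElem e) (b : Module.End A (Ideal.span {e}))
    (m : Ideal.span {e}) : b m = (m : A) • b (spanSelf e) := by
  rw [← map_smul, smul_spanSelf he]

theorem span_mul_top_le_traceIdeal :
    Ideal.span {e} * ⊤ ≤ traceIdeal A (Ideal.span {e}) := by
  refine Ideal.mul_le.2 fun x hx y _ => ?_
  exact Submodule.mem_iSup_of_mem ((LinearMap.toSpanSingleton A A y).domRestrict _) ⟨⟨x, hx⟩, rfl⟩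

variable (e) in
/-- The map `A e → End_A(A e)` that sends `m` to the right multiplication `x ↦ x m`. -/
def spanToEnd : Ideal.span {e} →ₗ[Module.End A (Ideal.span {e})] Module.End A (Ideal.span {e}) where
  toFun m := (Submodule.subtype _).smulRight m
  map_add' m m' := LinearMap.ext fun x => by simp
  map_smul' b m := LinearMap.ext fun x => by simp

theorem spanToEnd_spanSelf (he : IsIdempotentElem e) : spanToEnd e (spanSelf e) = 1 :=
  LinearMap.ext (smul_spanSelf he)

/-- The linear form on `End_A(A e) ≅ e A e` induced by a linear form on `A`. -/
def cornerForm {K : Type*} [CommSemiring K] [Algebra K A] (e : A) (θ : Module.Dual K A) :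
    Module.Dual K (Module.End A (Ideal.span {e})) where
  toFun b := θ (b (spanSelf e))
  map_add' b b' := by simp
  map_smul' k b := by simp

theorem cornerForm_apply {K : Type*} [CommSemiring K] [Algebra K A] (θ : Module.Dual K A)
    (b : Module.End A (Ideal.span {e})) : cornerForm e θ b = θ (b (spanSelf e)) := rfl

end SpanIdempotent

namespace IsNakayamaCounit

variable {K A : Type*} [Field K] [Ring A] [Algebra K A] {ε : Module.Dual K A →ₗ[K] A}
variable {θ : Module.Dual K A}

theorem map_mul_mul_comm (hε : IsNakayamaCounit ε) (x y : A) :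
    θ (x * ε θ * y) = θ (y * ε θ * x) := by
  have h := hε.comm θ (θ ∘ₗ LinearMap.mulRight K y) x
  rw [hε.map_mulRight] at h
  exact h

theorem isSymmetrizingForm_cornerForm (hε : IsNakayamaCounit ε) (he : IsIdempotentElem (ε θ)) :
    IsSymmetrizingForm (cornerForm (ε θ) θ) where
  map_mul_comm b b' := by
    have cornerForm_mul (b b' : Module.End A (Ideal.span {ε θ})) :
        cornerForm (ε θ) θ (b * b') = θ (b' (spanSelf (ε θ)) * ε θ * b (spanSelf (ε θ))) := by
      rw [cornerForm_apply, Module.End.mul_apply, end_span_apply he, coe_mul_eq_of_mem_span he]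
      rfl
    rw [cornerForm_mul, cornerForm_mul, hε.map_mul_mul_comm]
  eq_zero_of_forall b hb := by
    set x := b (spanSelf (ε θ)) with hx
    have map_mul_eq_zero (z : A) : θ (z * x) = 0 :=
      calc
        θ (z * x) = θ (z * x * ε θ * 1) := by
          rw [mul_one, mul_assoc, coe_mul_eq_of_mem_span he]
        _ = θ (ε θ * (z * x)) := by rw [hε.map_mul_mul_comm, one_mul]
        _ = θ (b (ε θ • z • spanSelf (ε θ))) := by rw [map_smul, map_smul]; rfl
        _ = 0 := hb (spanToEnd _ (z • spanSelf _))
    have x_eq_zero : x = 0 := Subtype.ext <|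
      calc
        (x : A) = ε (θ ∘ₗ LinearMap.mulRight K (x : A)) := by
          rw [hε.map_mulRight, coe_mul_eq_of_mem_span he]
        _ = 0 := by rw [show θ ∘ₗ _ = 0 from LinearMap.ext map_mul_eq_zero, map_zero]
    exact LinearMap.ext fun m => by
      rw [end_span_apply he, ← hx, x_eq_zero, smul_zero, LinearMap.zero_apply]

end IsNakayamaCounit

theorem IsSymmetrizingForm.op {K B : Type*} [CommSemiring K] [Semiring B] [Algebra K B]
    {τ : Module.Dual K B} (hτ : IsSymmetrizingForm τ) :
    IsSymmetrizingForm (τ ∘ₗ (MulOpposite.opLinearEquiv K).symm.toLinearMap) where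
  map_mul_comm x y := hτ.map_mul_comm y.unop x.unop
  eq_zero_of_forall _ hx := MulOpposite.unop_injective <| hτ.eq_zero_of_forall _ fun y =>
    (hτ.map_mul_comm _ _).trans (hx (MulOpposite.op y))

theorem isGendoSymmetric_of_algEquiv {K A E M : Type u} [Field K] [Ring A] [Algebra K A]
    [Ring E] [Algebra K E] [AddCommGroup M] [Module K M] [Module E M] [IsScalarTower K E M]
    [FiniteDimensional K E] [FiniteDimensional K M] {τ : Module.Dual K E}
    (hτ : IsSymmetrizingForm τ) {n : ℕ} {p : Fin n → M →ₗ[E] E} {m : Fin n → M}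
    (hpm : ∑ j, p j (m j) = 1) (α : A ≃ₐ[K] Module.End E M) : IsGendoSymmetric K A := by
  -- A left `E`-module is a right `Eᵐᵒᵖ`-module, hence encoded as a left `Eᵐᵒᵖᵐᵒᵖ`-module.
  let : Module Eᵐᵒᵖᵐᵒᵖ M := Module.compHom M (RingEquiv.opOp E).symm.toRingHom
  have : IsScalarTower K Eᵐᵒᵖᵐᵒᵖ M := ⟨fun k b m => smul_assoc k b.unop.unop m⟩
  let endEquiv : Module.End E M ≃ₐ[K] Module.End Eᵐᵒᵖᵐᵒᵖ M :=
    { toFun g := { g with map_smul' := fun b => g.map_smul b.unop.unop }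
      invFun g := { g with map_smul' := fun b => g.map_smul (.op (.op b)) }
      left_inv _ := rfl
      right_inv _ := rfl
      map_mul' _ _ := rfl
      map_add' _ _ := rfl
      commutes' _ := rfl }
  refine ⟨Eᵐᵒᵖ, inferInstance, inferInstance, M, inferInstance, inferInstance, inferInstance,
    inferInstance, isSymmetricAlg_iff.2 ⟨inferInstance, _, hτ.op⟩, inferInstance,
    isRightGenerator_iff.2 ⟨n, fun j => ?_, m, ?_⟩, ⟨α.trans endEquiv⟩⟩
  · exact
      { toFun x := .op (p j x)
        map_add' x y := congrArg _ (map_add (p j) x y)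
        map_smul' b x := congrArg _ (map_smul (p j) b.unop.unop x) }
  · exact MulOpposite.unop_injective (by simpa using hpm)

theorem IsNakayamaCounit.isGendoSymmetric {K A : Type u} [Field K] [Ring A] [Algebra K A]
    [FiniteDimensional K A] {ε : Module.Dual K A →ₗ[K] A} (hε : IsNakayamaCounit ε) :
    IsGendoSymmetric K A := by
  have : IsArtinianRing A := IsArtinianRing.of_finite K A
  obtain ⟨_, ⟨θ, rfl⟩, he, rangeIdeal_eq⟩ :=
    exists_isIdempotentElem_eq_span_mul_top hε.isIdempotentElem_rangeIdeal
  let M := Ideal.span {ε θ}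
  have mem_traceIdeal (c : Module.Dual K A) : ε c ∈ traceIdeal A M :=
    span_mul_top_le_traceIdeal (rangeIdeal_eq ▸ hε.mem_rangeIdeal.2 ⟨c, rfl⟩)
  have exists_smul_eq (m : M) : ∃ c m', ε c • m' = m := by
    refine ⟨θ ∘ₗ LinearMap.mulRight K (m : A), spanSelf (ε θ), ?_⟩
    rw [hε.map_mulRight, coe_mul_eq_of_mem_span he, smul_spanSelf he]
  have : FiniteDimensional K (Module.End A M) :=
    .of_injective (LinearMap.restrictScalarsₗ K A M M K) (LinearMap.restrictScalars_injective K)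
  exact isGendoSymmetric_of_algEquiv (hε.isSymmetrizingForm_cornerForm he) (n := 1)
    (p := fun _ => spanToEnd (ε θ)) (m := fun _ => spanSelf (ε θ)) (by simp [spanToEnd_spanSelf he])
    (.ofBijective _ (hε.bijective_lsmul mem_traceIdeal exists_smul_eq))

theorem isGendoSymmetric_iff_exists_isNakayamaCounit (K A : Type u) [Field K] [Ring A]
    [Algebra K A] [FiniteDimensional K A] :
    IsGendoSymmetric K A ↔ ∃ ε : Module.Dual K A →ₗ[K] A, IsNakayamaCounit ε :=
  ⟨fun hA => hA.exists_isNakayamaCounit, fun ⟨_, hε⟩ => hε.isGendoSymmetric⟩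

theorem exists_comonad_iff_exists_isNakayamaCounit (K A : Type u) [Field K] [Ring A]
    [Algebra K A] [FiniteDimensional K A] :
    (∃ G : Comonad (FGModuleCat.{u} Aᵐᵒᵖ), G.toFunctor = nakayamaFunctor K A) ↔
      ∃ ε : Module.Dual K A →ₗ[K] A, IsNakayamaCounit ε :=
  ⟨fun ⟨_, hG⟩ => exists_isNakayamaCounit_of_comonad hG, fun ⟨_, hε⟩ => hε.exists_comonad⟩

theorem mainTheorem4 (K : Type u) [Field K] (A : Type u) [Ring A] [Algebra K A]
    [FiniteDimensional K A] :
    IsGendoSymmetric K A ↔ ∃ G : Comonad (FGModuleCat.{u} Aᵐᵒᵖ), G.toFunctor = nakayamaFunctor K A :=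
  (isGendoSymmetric_iff_exists_isNakayamaCounit K A).trans
    (exists_comonad_iff_exists_isNakayamaCounit K A).symm
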